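/- Let $G=(\mathcal V,\mathcal E)$ be a finite directed acyclic multigraph, and let $\mathcal N=(G,S,\gamma)$ be a network with $s\ge 1$ distinct source nodes $S=\{\sigma_1,\dots,\sigma_s\}\subseteq\mathcal V$ and a sink $\gamma\in\mathcal V\setminus S$, such that no source has an incoming edge and every node other than $\gamma$ has a directed path to $\gamma$. For $C\subseteq\mathcal E$ let $I_C\subseteq S$ be the set of sources that have no path to $\gamma$ after the edges in $C$ are deleted, and let $\Lambda(\mathcal N)=\{C\subseteq\mathcal E : I_C\neq\varnothing\}$ be the set of cuts. Let $\mathbb F_q$ be the finite field with $q$ elements. In a $(k,n)$ network code over $\mathbb F_q$ ($k,n\ge 1$), each source $\sigma_i$ generates a vector in $\mathbb F_q^k$. Each edge $e$ carries a vector in $\mathbb F_q^n$, namely a function (fixed by the code) of the vector generated at the tail of $e$, if that tail is a source, or of the vectors received on the incoming edges of the tail otherwise, plus an error vector $z_e\in\mathbb F_q^n$. The sink decodes from the vectors it receives on its incoming edges. The code computes $f:\mathbb F_q^s\to\mathcal O$ against $\tau$ errors if, for all source vectors $(x_{i1},\dots,x_{ik})$, $1\le i\le s$, and all errors $(z_e)_{e\in\mathcal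 E}$ with $z_e\ne 0$ for at most $\tau$ edges $e$, the sink outputs the $k$ values $f(x_{1j},\dots,x_{sj})$, $1\le j\le k$. The robust computing capacity is $$C(\mathcal N,f,\tau)=\sup\{k/n : \text{some } (k,n) \text{ network code over } \mathbb F_q \text{ computes } f \text{ against } \tau \text{ errors}\},$$ the supremum of the empty set being $0$. Write $C(\mathcal N,T,\tau)$ for $f(\mathbf x)=\mathbf x\cdot T$, where $T$ is a matrix with $s$ rows; $\mathbf 1$ is the all-one $s\times 1$ matrix (the sum function) and $I$ is the $s\times s$ identity matrix. Theorem. Let $\tau\ge 1$ be an integer with $2\tau<\min_{C\in\Lambda(\mathcal N)}|C|$. Then there is $q_0$, depending only on $\mathcal N$ and $\tau$, such that for every prime power $q\ge q_0$, $$C(\mathcal N,\mathbf 1,\tau)=\min_{C\in\Lambda(\mathcal N)}(|C|-2\tau)$$ (that is, $C(\mathcal N,\mathbf 1,\tau)\ge\min_{C\in\Lambda(\mathcal N)}(|C|-2\tau)$, matching the cut-set upper bound), and $$C(\mathcal N,I,\tau)\ge\min_{C\in\Lambda(\mathcal N)}\left\lfloor\frac{|C|-2\tau}{|I_C|}\right\rfloor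 .$$ -/

import Mathlib

open scoped ENNReal Matrix

/-- A directed multigraph on the vertex type `V` with edge type `E`: parallel edges are allowed. -/
structure DiMultigraph (V E : Type*) where
  tail : E → V
  head : E → V

/-- `G.Reaches C u v`: there is a (nonempty) directed path
from `u` to `v` none of whose edges lies in `C`. -/
def DiMultigraph.Reaches {V E : Type*} (G : DiMultigraph V E) (C : Finset E) (u v : V) : Prop :=
  Relation.TransGen (fun a b => ∃ e, e ∉ C ∧ G.tail e = a ∧ G.head e = b) u v

/-- A network `(G, S, γ)` with source nodes `S = {σ_1, …, σ_s}` (listed without repetition) and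
sink `γ ∉ S` over a directed acyclic multigraph `G`. Sources have no incoming edges, and
every node other than the sink has a directed path to the sink. -/
structure Network (V E : Type*) (s : ℕ) extends DiMultigraph V E where
  source : Fin s ↪ V
  sink : V
  acyclic : ∀ v, ¬ toDiMultigraph.Reaches ∅ v v
  source_ne_sink : ∀ i, source i ≠ sink
  head_ne_source : ∀ e i, head e ≠ source i
  reaches_sink : ∀ u, u ≠ sink → toDiMultigraph.Reaches ∅ u sink

namespace Network

/-- `I_C`: the (indices of) sources without a path to the sink once the edges in `C` are deleted. -/
def separated {V E : Type*} {s : ℕ} (N : Network V E s) (C : Finset E) : Set (Fin s) :=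
  {i | ¬ N.Reaches C (N.source i) N.sink}

/-- `Λ(N)`: the edge sets that meet every path from some source to the sink. -/
def cuts {V E : Type*} {s : ℕ} (N : Network V E s) : Set (Finset E) :=
  {C | ∃ i, ¬ N.Reaches C (N.source i) N.sink}

end Network

/-- A `(k, n)` network code over the alphabet `A` for computing functions with values in `O`.
Source `i` generates a vector in `A ^ k`, and every edge carries a vector in `A ^ n`. The message
sent on `e` is a function of the vector generated at the tail of `e` (if that is a source) and of
the messages on the incoming edges of the tail of `e`. The sink decodes `k` function values from
the messages on its incoming edges. -/
structure NetworkCode {V E : Type*} {s : ℕ} (N : Network V E s) (A O : Type*) (k n : ℕ) where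
  enc : ∀ e : E, ({i : Fin s // N.source i = N.tail e} → Fin k → A) →
    ({d : E // N.head d = N.tail e} → Fin n → A) → Fin n → A
  dec : ({e : E // N.head e = N.sink} → Fin n → A) → Fin k → O

namespace NetworkCode

/-- `u` is the family of messages actually carried by the edges when the sources generate `x` and
the error message `z e` is added on each edge `e`. -/
def IsTransmission {V E A O : Type*} {s k n : ℕ} {N : Network V E s} [Add A]
    (c : NetworkCode N A O k n) (x : Fin s → Fin k → A) (z u : E → Fin n → A) : Prop :=
  ∀ e, u e = c.enc e (fun i => x i) (fun d => u d) + z e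

/-- By acyclicity, the source messages and the errors determine the transmitted messages. -/
theorem existsUnique_isTransmission {V E A O : Type*} {s k n : ℕ} {N : Network V E s} [Add A]
    [Finite E] (c : NetworkCode N A O k n) (x : Fin s → Fin k → A) (z : E → Fin n → A) :
    ∃! u, c.IsTransmission x z u := by
  have key : ∀ d e, Relation.TransGen (fun d e => N.head d = N.tail e) d e →
      N.Reaches ∅ (N.tail d) (N.tail e) := by
    intro d e h
    induction h with
    | single h => exact .single ⟨d, by simp, rfl, h⟩
    | @tail b _ _ h ih => exact ih.tail ⟨b, by simp, rfl, h⟩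
  have : Std.Irrefl (Relation.TransGen fun d e => N.head d = N.tail e) :=
    ⟨fun e h => N.acyclic _ (key e e h)⟩
  have wf' := Finite.wellFounded_of_trans_of_irrefl
    (Relation.TransGen fun d e => N.head d = N.tail e)
  have wf : WellFounded fun d e => N.head d = N.tail e :=
    Subrelation.wf (r := Relation.TransGen fun d e => N.head d = N.tail e)
      (fun h => Relation.TransGen.single h) wf'
  refine ⟨wf.fix fun e ih => c.enc e (fun i => x i) (fun d => ih d.1 d.2) + z e, ?_, ?_⟩
  · intro e
    exact wf.fix_eq _ e
  · intro u hu
    funext e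
    induction e using wf.induction with
    | _ e ih =>
      rw [hu e, wf.fix_eq]
      congr 2
      funext d
      exact ih d.1 d.2

/-- `c` computes the target function `f` (`k` times) against `τ` errors: whatever the source
messages `x`, the error pattern `ρ` of at most `τ` edges, and the error vector `z` matching `ρ`,
the sink outputs the `k` values of `f`. -/
def Computes {V E A O : Type*} {s k n : ℕ} {N : Network V E s} [AddZeroClass A]
    (c : NetworkCode N A O k n) (f : (Fin s → A) → O) (τ : ℕ) : Prop :=
  ∀ (x : Fin s → Fin k → A) (ρ : Finset E) (z u : E → Fin n → A),
    ρ.card ≤ τ → (∀ e, e ∉ ρ → z e = 0) → c.IsTransmission x z u →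
      c.dec (fun e => u e) = fun j => f (fun i => x i j)

end NetworkCode

/-- The robust computing capacity `C(N, f, τ)`: the supremum of the rates `k / n` of the `(k, n)`
network codes, `k, n ≥ 1`, over the alphabet of `f` that compute `f` against `τ` errors. -/
noncomputable def robustCapacity {V E A O : Type*} {s : ℕ} [AddZeroClass A] (N : Network V E s)
    (f : (Fin s → A) → O) (τ : ℕ) : ℝ≥0∞ :=
  sSup {r | ∃ k n : ℕ, 0 < k ∧ 0 < n ∧ (∃ c : NetworkCode N A O k n, c.Computes f τ) ∧
    r = (k : ℝ≥0∞) / n}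

/-- The linear target function `x ↦ x · T`. -/
def linearTarget {F : Type*} [Field F] {s l : ℕ} (T : Matrix (Fin s) (Fin l) F) :
    (Fin s → F) → (Fin l → F) :=
  fun x => x ᵥ* T

/-! Linear coding is described dually. Each edge `e` gets a vector `K e`, the effect at the sink of
a unit error on `e`; it lies in the span of the vectors on the edges leaving the head of `e`, and is
unrestricted if the head is the sink. Source symbols get vectors `g` likewise. The sink then sees `∑
x • g + ∑ z • K`, and `τ` errors are corrected as soon as a combination of the `g` in the span of
`2τ` vectors `K e` always has target value zero.

The vectors are chosen generically, from the sink backwards. By `generic_vectors_independent`, those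
lying in a subspace `U` although their available space does not are independent, so there are at
most `dim U` of them. For `U ≠ ⊤`, the edges of this kind cut off every source whose available space
lies in `U` (`mem_separated_of_outSpan_le`). Cut sizes thus become dimension bounds. For the sum, in
dimension `w + 2τ`, they force every source to have the whole space available, so all sources share
the same generic `g`. For the identity, a bad relation yields a cut `C` with `|C| < r|I_C| + 2τ`.

For the upper bound, two messages agreeing on all but the last `2τ` edges of a cut are made
indistinguishable by `τ` errors each. -/

/-! ### Topological numberings -/

/-- A finite type with a transitive irreflexive relation can be numbered compatibly. -/
theorem exists_injective_nat_of_isStrictOrder {α : Type*} [Finite α] (R : α → α → Prop)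
    (htrans : ∀ a b c, R a b → R b c → R a c) (hirr : ∀ a, ¬ R a a) :
    ∃ i : α → ℕ, Function.Injective i ∧ ∀ a b, R a b → i a < i b := by
  classical
  have : IsPartialOrder α (fun a b => a = b ∨ R a b) :=
    { refl := fun a => .inl rfl
      trans := by
        rintro a b c (rfl | h) (rfl | h')
        · exact .inl rfl
        · exact .inr h'
        · exact .inr h
        · exact .inr (htrans _ _ _ h h')
      antisymm := by
        rintro a b (rfl | h) (h' | h')
        · rfl
        · rfl
        · exact h'.symm
        · exact (hirr _ (htrans _ _ _ h h')).elim }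
  obtain ⟨t, ht, hle⟩ := extend_partialOrder (fun a b => a = b ∨ R a b)
  have key : ∀ a b, t a b → a ≠ b →
      {c | t c a ∧ c ≠ a}.ncard < {c | t c b ∧ c ≠ b}.ncard := by
    intro a b hab hne
    apply Set.ncard_lt_ncard _ (Set.toFinite _)
    refine ⟨fun c hc => ⟨_root_.trans hc.1 hab, ?_⟩, fun h => ?_⟩
    · rintro rfl
      exact hne (antisymm hab hc.1)
    · exact (h (a := a) ⟨hab, hne⟩).2 rfl
  refine ⟨fun a => {c | t c a ∧ c ≠ a}.ncard, fun a b h => ?_, fun a b h => ?_⟩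
  · by_contra hne
    rcases total_of t a b with h' | h'
    · exact (key a b h' hne).ne h
    · exact (key b a h' (Ne.symm hne)).ne h.symm
  · exact key a b (hle _ _ (.inr h)) (by rintro rfl; exact hirr _ h)

/-- The edges of a network can be numbered along the direction of transmission. -/
theorem Network.exists_topological_numbering {V E : Type*} [Finite E] {s : ℕ}
    (N : Network V E s) :
    ∃ i : E → ℕ, Function.Injective i ∧ ∀ d e, N.head d = N.tail e → i d < i e := by
  have key : ∀ d e, Relation.TransGen (fun d e => N.head d = N.tail e) d e →
      N.Reaches ∅ (N.tail d) (N.tail e) := by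
    intro d e h
    induction h with
    | single h => exact .single ⟨d, by simp, rfl, h⟩
    | @tail b _ _ h ih => exact ih.tail ⟨b, by simp, rfl, h⟩
  obtain ⟨i, hi, h⟩ := exists_injective_nat_of_isStrictOrder
    (Relation.TransGen fun d e : E => N.head d = N.tail e)
    (fun _ _ _ => Relation.TransGen.trans) (fun e h => N.acyclic _ (key e e h))
  exact ⟨i, hi, fun d e hde => h d e (.single hde)⟩

/-! ### Generic choice of vectors -/

/-- Over a large field, a subspace is not covered by few subspaces not containing it. -/
theorem Submodule.exists_mem_forall_notMem {F M ι : Type*} [Field F] [Finite F] [AddCommGroup M]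
    [Module F M] (V : Submodule F M) (p : ι → Submodule F M) (t : Finset ι)
    (hp : ∀ i ∈ t, ¬ V ≤ p i) (ht : t.card < Nat.card F) : ∃ x ∈ V, ∀ i ∈ t, x ∉ p i := by
  classical
  have := Fintype.ofFinite F
  induction t using Finset.induction_on with
  | empty => exact ⟨0, V.zero_mem, by simp⟩
  | insert a t ha ih =>
    rw [Finset.card_insert_of_notMem ha] at ht
    obtain ⟨x, hxV, hx⟩ := ih (fun i hi => hp i (Finset.mem_insert_of_mem hi)) (by omega)
    by_cases hxa : x ∈ p a
    swap
    · exact ⟨x, hxV, by simpa [hxa] using hx⟩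
    obtain ⟨y, hyV, hya⟩ := SetLike.not_le_iff_exists.1 (hp a (Finset.mem_insert_self a t))
    -- The line `y + c • x` avoids `p a` altogether and meets each other `p i` at most once, since
    -- `x ∉ p i`.
    have hbad : ∀ i : ι, ∃ c₀ : F, i ∈ t → ∀ c : F, y + c • x ∈ p i → c = c₀ := by
      intro i
      by_cases h : ∃ c₀ : F, y + c₀ • x ∈ p i
      · obtain ⟨c₀, h₀⟩ := h
        refine ⟨c₀, fun hi c hc => ?_⟩
        by_contra hne
        apply hx i hi
        have := (p i).sub_mem hc h₀
        rw [add_sub_add_left_eq_sub, ← sub_smul] at this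
        exact ((p i).smul_mem_iff (sub_ne_zero.2 hne)).1 this
      · exact ⟨0, fun _ c hc => (h ⟨c, hc⟩).elim⟩
    choose c₀ hc₀ using hbad
    obtain ⟨c, hc⟩ : ∃ c, c ∉ t.image c₀ := by
      by_contra! h
      have h1 := Finset.card_image_le (s := t) (f := c₀)
      rw [Finset.eq_univ_of_forall h, Finset.card_univ, ← Nat.card_eq_fintype_card] at h1
      omega
    refine ⟨y + c • x, V.add_mem hyV (V.smul_mem _ hxV), fun i hi h => ?_⟩
    rcases Finset.mem_insert.1 hi with rfl | hi
    · exact hya (((p i).add_mem_iff_left ((p i).smul_mem _ hxa)).1 h)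
    · exact hc (Finset.mem_image.2 ⟨i, hi, (hc₀ i hi c h).symm⟩)

/-- Vectors can be chosen one after the other, the one of `e` in the span of a given subspace and
given earlier vectors, and as generic as possible with respect to the earlier ones. -/
theorem exists_generic_vectors {F M D : Type*} [Field F] [Finite F] [AddCommGroup M] [Module F M]
    [Finite D] (hF : 2 ^ Nat.card D < Nat.card F) (i : D → ℕ) (T : D → Submodule F M)
    (P : D → Set D) (hP : ∀ e, ∀ d ∈ P e, i d < i e) :
    ∃ K : D → M, ∀ e, K e ∈ T e ⊔ Submodule.span F (K '' P e) ∧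
      ∀ Y : Set D, (∀ d ∈ Y, i d < i e) → K e ∈ Submodule.span F (K '' Y) →
        T e ⊔ Submodule.span F (K '' P e) ≤ Submodule.span F (K '' Y) := by
  classical
  have := Fintype.ofFinite D
  have step : ∀ (e : D) (K : D → M), ∃ x : M, x ∈ T e ⊔ Submodule.span F (K '' P e) ∧
      ∀ Y : Set D, x ∈ Submodule.span F (K '' Y) →
        T e ⊔ Submodule.span F (K '' P e) ≤ Submodule.span F (K '' Y) := by
    intro e K
    -- One subspace is to be avoided for each subset `Y` of `D`, whence the bound `2 ^ Nat.card D`.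
    obtain ⟨x, hx, h⟩ := (T e ⊔ Submodule.span F (K '' P e)).exists_mem_forall_notMem
      (fun Y : Set D => Submodule.span F (K '' Y))
      (Finset.univ.filter fun Y : Set D =>
        ¬ T e ⊔ Submodule.span F (K '' P e) ≤ Submodule.span F (K '' Y)) (by simp) (by
        refine (Finset.card_filter_le _ _).trans_lt ?_
        rwa [Finset.card_univ, Fintype.card_set, ← Nat.card_eq_fintype_card])
    refine ⟨x, hx, fun Y hY => ?_⟩
    by_contra hle
    exact h Y (by simpa using hle) hY
  choose f hf using step
  have wf : WellFounded fun d e : D => i d < i e := InvImage.wf i wellFounded_lt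
  let K : D → M := wf.fix fun e ih => f e fun d => if h : i d < i e then ih d h else 0
  have hK : ∀ e, K e = f e fun d => if i d < i e then K d else 0 := by
    intro e
    have := wf.fix_eq (fun e ih => f e fun d => if h : i d < i e then ih d h else 0) e
    simpa [K] using this
  have himg : ∀ (e : D) (Y : Set D), (∀ d ∈ Y, i d < i e) →
      (fun d => if i d < i e then K d else 0) '' Y = K '' Y :=
    fun e Y hY => Set.image_congr fun d hd => if_pos (hY d hd)
  refine ⟨K, fun e => ?_⟩
  obtain ⟨h1, h2⟩ := hf e fun d => if i d < i e then K d else 0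
  rw [← hK, himg e _ (hP e)] at h1
  refine ⟨h1, fun Y hY hmem => ?_⟩
  have := h2 Y
  rw [← hK, himg e _ hY, himg e _ (hP e)] at this
  exact this hmem

/-- In a nontrivial relation, the last `K d` with nonzero coefficient lies in the span of earlier
vectors from `S` and `Y`. These all lie in `U`, so genericity puts `W d` inside `U`, against `hS`.
Independence modulo `Y` is what separates messages from errors. -/
theorem generic_vectors_independent {F M D : Type*} [Field F] [AddCommGroup M]
    [Module F M] {i : D → ℕ} (hi : Function.Injective i) {K : D → M} {W : D → Submodule F M}
    (hgen : ∀ e, ∀ Y : Set D, (∀ d ∈ Y, i d < i e) → K e ∈ Submodule.span F (K '' Y) →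
      W e ≤ Submodule.span F (K '' Y))
    (U : Submodule F M) (S : Finset D) (Y : Set D) (hYS : ∀ y ∈ Y, ∀ d ∈ S, i y < i d)
    (hYU : ∀ y ∈ Y, K y ∈ U) (hSU : ∀ d ∈ S, K d ∈ U) (hS : ∀ d ∈ S, ¬ W d ≤ U) (c : D → F)
    (hc : ∑ d ∈ S, c d • K d ∈ Submodule.span F (K '' Y)) : ∀ d ∈ S, c d = 0 := by
  classical
  by_contra! hne
  obtain ⟨d, hd, hmax⟩ := (S.filter fun d => c d ≠ 0).exists_max_image i
    (by obtain ⟨d, hd, h⟩ := hne; exact ⟨d, by simp [hd, h]⟩)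
  rw [Finset.mem_filter] at hd
  let Z : Set D := Y ∪ {a | a ∈ S ∧ i a < i d}
  have hrest : ∑ a ∈ S.erase d, c a • K a ∈ Submodule.span F (K '' Z) := by
    refine Submodule.sum_mem _ fun a ha => ?_
    rw [Finset.mem_erase] at ha
    by_cases hca : c a = 0
    · simp [hca]
    · refine Submodule.smul_mem _ _ (Submodule.subset_span ⟨a, .inr ⟨ha.2, ?_⟩, rfl⟩)
      exact lt_of_le_of_ne (hmax a (by simp [ha.2, hca])) fun h => ha.1 (hi h)
  have hall := Submodule.span_mono (Set.image_mono (Set.subset_union_left : Y ⊆ Z)) hc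
  rw [← Finset.add_sum_erase _ _ hd.1, Submodule.add_mem_iff_left _ hrest,
    Submodule.smul_mem_iff _ hd.2] at hall
  refine hS d hd.1 ((hgen d Z ?_ hall).trans (Submodule.span_le.2 ?_))
  · rintro a (ha | ha)
    · exact hYS a ha d hd.1
    · exact ha.2
  · rintro _ ⟨a, ha | ha, rfl⟩
    · exact hYU a ha
    · exact hSU a ha.1

/-! ### Dual coding vectors and cuts -/

/-- The space available at the node `v` when the edges carry the (dual) coding vectors `K`:
everything at the sink, and the span of the vectors of the outgoing edges at other nodes. -/
def Network.outSpan {V E : Type*} {s : ℕ} (N : Network V E s) (F : Type*) {M : Type*} [Field F]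
    [AddCommGroup M] [Module F M] (K : E → M) (v : V) : Submodule F M :=
  (⨆ _ : v = N.sink, ⊤) ⊔ Submodule.span F (K '' {d | N.tail d = v})

namespace Network

variable {V E F M : Type*} {s : ℕ} (N : Network V E s) [Field F] [AddCommGroup M] [Module F M]

theorem outSpan_sink (K : E → M) : N.outSpan F K N.sink = ⊤ := by
  simp [outSpan]

theorem outSpan_of_ne (K : E → M) {v : V} (hv : v ≠ N.sink) :
    N.outSpan F K v = Submodule.span F (K '' {d | N.tail d = v}) := by
  simp [outSpan, hv]

theorem mem_outSpan (K : E → M) (e : E) : K e ∈ N.outSpan F K (N.tail e) :=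
  Submodule.mem_sup_right (Submodule.subset_span ⟨e, rfl, rfl⟩)

/-- Generic coding vectors of the edges, together with further vectors `g b` which are generic
among those available at given nodes `h b`. -/
theorem exists_generic_coding_vectors [Finite F] [Finite E] [FiniteDimensional F M]
    {B : Type*} [Fintype B] (h : B → V) (hF : 2 ^ (Nat.card E + Nat.card B) < Nat.card F) :
    ∃ (K : E → M) (g : B → M), (∀ e, K e ∈ N.outSpan F K (N.head e)) ∧
      (∀ b, g b ∈ N.outSpan F K (h b)) ∧
      (∀ (U : Submodule F M) (ρ : Set E), (∀ e ∈ ρ, K e ∈ U) → (∀ b, g b ∈ U) →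
        (∀ b, ¬ N.outSpan F K (h b) ≤ U) → ∀ c : B → F,
          ∑ b, c b • g b ∈ Submodule.span F (K '' ρ) → c = 0) ∧
      (∀ (U : Submodule F M) (S : Finset E) (T : Finset B),
        (∀ e ∈ S, K e ∈ U) → (∀ e ∈ S, ¬ N.outSpan F K (N.head e) ≤ U) →
        (∀ b ∈ T, g b ∈ U) → (∀ b ∈ T, ¬ N.outSpan F K (h b) ≤ U) →
          S.card + T.card ≤ Module.finrank F U) := by
  classical
  have := Fintype.ofFinite E
  obtain ⟨j, hj, hjt⟩ := N.exists_topological_numbering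
  obtain ⟨m, hm⟩ : ∃ m, ∀ e, j e < m := by
    obtain ⟨m, hm⟩ := (Set.finite_range j).bddAbove
    exact ⟨m + 1, fun e => Nat.lt_succ_of_le (hm ⟨e, rfl⟩)⟩
  -- Edges are ranked backwards from the sink, so `K e` is chosen after the vectors of the edges
  -- leaving its head; the `g b` come after all edges.
  let i : E ⊕ B → ℕ := Sum.elim (fun e => m - j e) fun b => m + 1 + Fintype.equivFin B b
  have hi : Function.Injective i := by
    rintro (a | a) (b | b) hab
    · have := hm a; have := hm b
      simp only [i, Sum.elim_inl] at hab
      rw [hj (by omega : j a = j b)]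
    · simp only [i, Sum.elim_inl, Sum.elim_inr] at hab
      omega
    · simp only [i, Sum.elim_inl, Sum.elim_inr] at hab
      omega
    · simp only [i, Sum.elim_inr] at hab
      rw [(Fintype.equivFin B).injective (Fin.ext (Nat.add_left_cancel hab))]
  have hlt : ∀ (e : E) (b : B), i (.inl e) < i (.inr b) := by
    intro e b
    simp only [i, Sum.elim_inl, Sum.elim_inr]
    omega
  let H : E ⊕ B → V := Sum.elim N.head h
  obtain ⟨K, hK⟩ := exists_generic_vectors (F := F) (M := M) (by rwa [Nat.card_sum]) i
    (fun e => ⨆ _ : H e = N.sink, ⊤) (fun e => Sum.inl '' {d | N.tail d = H e}) (by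
      rintro (e | b) _ ⟨d, hd, rfl⟩
      · have := hjt e d hd.symm
        have := hm d
        simp only [i, Sum.elim_inl]
        omega
      · exact hlt d b)
  have hW : ∀ e, (⨆ _ : H e = N.sink, ⊤) ⊔
      Submodule.span F (K '' (Sum.inl '' {d | N.tail d = H e})) =
        N.outSpan F (fun e => K (.inl e)) (H e) := by
    intro e
    rw [outSpan, Set.image_image]
  simp only [hW] at hK
  refine ⟨fun e => K (.inl e), fun b => K (.inr b), fun e => (hK (.inl e)).1,
    fun b => (hK (.inr b)).1, ?_, ?_⟩
  · intro U ρ hρ hg hU c hc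
    have := generic_vectors_independent hi (fun e => (hK e).2) U (Finset.univ.map .inr)
      (Sum.inl '' ρ) (by simpa using fun e _ b => hlt e b) (by simpa using hρ) (by simpa using hg)
      (by simpa [H] using hU) (Sum.elim 0 c) (by simpa [Set.image_image] using hc)
    funext b
    simpa using this (.inr b) (by simp)
  · intro U S T hSU hS hTU hT
    have hind : LinearIndepOn F K (S.disjSum T : Set (E ⊕ B)) := by
      rw [linearIndepOn_finset_iff]
      intro c hc
      refine generic_vectors_independent hi (fun e => (hK e).2) U (S.disjSum T) ∅ (by simp)
        (by simp) ?_ ?_ c (by simp [hc])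
      · rintro (e | b) hd
        · exact hSU e (by simpa using hd)
        · exact hTU b (by simpa using hd)
      · rintro (e | b) hd
        · exact hS e (by simpa using hd)
        · exact hT b (by simpa using hd)
    have h1 := finrank_span_eq_card hind.linearIndependent
    rw [← Nat.card_eq_fintype_card, Nat.card_coe_set_eq, Set.ncard_coe_finset,
      Finset.card_disjSum] at h1
    rw [← h1]
    apply Submodule.finrank_mono
    rw [Submodule.span_le]
    rintro _ ⟨⟨e | b, hd⟩, rfl⟩
    · exact hSU e (by simpa using hd)
    · exact hTU b (by simpa using hd)

/-- The edges whose vector lies in `U` although some vector at their head does not form a cut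
for the sources all of whose available vectors lie in `U`. -/
theorem mem_separated_of_outSpan_le (K : E → M) {U : Submodule F M} (hU : U ≠ ⊤)
    (C : Finset E) (hC : ∀ e, K e ∈ U → ¬ N.outSpan F K (N.head e) ≤ U → e ∈ C) {i : Fin s}
    (hi : N.outSpan F K (N.source i) ≤ U) : i ∈ N.separated C := by
  intro hreach
  have : N.outSpan F K N.sink ≤ U := by
    have key : ∀ v, N.Reaches C (N.source i) v → N.outSpan F K v ≤ U := by
      intro v hv
      induction hv with
      | single h =>
        obtain ⟨e, he, ht, rfl⟩ := h
        by_contra hle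
        exact he (hC e (hi (ht ▸ N.mem_outSpan K e)) hle)
      | tail _ h ih =>
        obtain ⟨e, he, ht, rfl⟩ := h
        by_contra hle
        exact he (hC e (ih (ht ▸ N.mem_outSpan K e)) hle)
    exact key _ hreach
  rw [outSpan_sink] at this
  exact hU (top_le_iff.1 this)

end Network

/-! ### From dual vectors to codes -/

namespace Network

/-- Dual description of scalar linear network coding: if the vector `K e` of every edge `e` is in
the span of the vectors of the edges following `e`, and the vectors `g i j` in the span of those of
the edges leaving source `i`, then there is a code for which the sink obtains
`∑ x i j • g i j + ∑ z e • K e`. -/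
theorem exists_linear_enc {V E F M : Type*} {s k : ℕ} (N : Network V E s) [Field F] [Fintype E]
    [AddCommGroup M] [Module F M] [Fintype {e : E // N.head e = N.sink}] (K : E → M)
    (hK : ∀ e, K e ∈ N.outSpan F K (N.head e)) (g : Fin s → Fin k → M)
    (hg : ∀ i j, g i j ∈ N.outSpan F K (N.source i)) :
    ∃ enc : ∀ e : E, ({i : Fin s // N.source i = N.tail e} → Fin k → F) →
        ({d : E // N.head d = N.tail e} → Fin 1 → F) → Fin 1 → F,
      ∀ (x : Fin s → Fin k → F) (z u : E → Fin 1 → F),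
        (∀ e, u e = enc e (fun i => x i) (fun d => u d) + z e) →
          ∑ e : {e : E // N.head e = N.sink}, u e 0 • K e =
            ∑ i, ∑ j, x i j • g i j + ∑ e, z e 0 • K e := by
  classical
  have hspan : ∀ v, v ≠ N.sink → ∀ y ∈ N.outSpan F K v, ∃ a : E → F,
      ∑ d : E, (if N.tail d = v then a d else 0) • K d = y := by
    intro v hv y hy
    rw [N.outSpan_of_ne K hv, Fintype.mem_span_image_iff_exists_fun] at hy
    obtain ⟨a, rfl⟩ := hy
    refine ⟨fun d => if h : N.tail d = v then a ⟨d, h⟩ else 0, ?_⟩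
    simp only [ite_smul, zero_smul]
    rw [← Finset.sum_filter, Finset.sum_subtype (p := (· ∈ {d | N.tail d = v})) _ (by simp)]
    refine Finset.sum_congr rfl fun d _ => ?_
    rw [dif_pos (show N.tail d = v from d.2)]
  choose a ha using fun e : {e : E // N.head e ≠ N.sink} => hspan _ e.2 _ (hK e)
  choose b hb using fun (i : Fin s) (j : Fin k) => hspan _ (N.source_ne_sink i) _ (hg i j)
  -- The coefficients expanding `K e` over the edges `d` that follow serve as local coding
  -- coefficients from `e` to `d`.
  let A : E → E → F := fun e d => if h : N.head e ≠ N.sink then a ⟨e, h⟩ d else 0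
  refine ⟨fun d x u _ => ∑ e, u e 0 * A e d + ∑ i, ∑ j, x i j * b i j d, fun x z u hu => ?_⟩
  have hA : ∀ e, ∑ d, (if N.head e = N.tail d then A e d else 0) • K d =
      if N.head e = N.sink then 0 else K e := by
    intro e
    split_ifs with h
    · simp [A, h]
    · rw [← ha ⟨e, h⟩]
      exact Finset.sum_congr rfl fun d _ => by
        rw [show A e d = a ⟨e, h⟩ d from dif_pos h]
        simp only [eq_comm (a := N.head e)]
  have hu' : ∀ d, u d 0 = ∑ e, u e 0 * (if N.head e = N.tail d then A e d else 0) +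
      ∑ i, ∑ j, x i j * (if N.tail d = N.source i then b i j d else 0) + z d 0 := by
    intro d
    have h1 : ∑ e : {e : E // N.head e = N.tail d}, u e 0 * A e d =
        ∑ e, u e 0 * (if N.head e = N.tail d then A e d else 0) := by
      simp only [mul_ite, mul_zero]
      rw [← Finset.sum_filter, Finset.sum_subtype (p := fun e => N.head e = N.tail d) _ (by simp)]
    have h2 : ∑ i : {i : Fin s // N.source i = N.tail d}, ∑ j, x i j * b i j d =
        ∑ i, ∑ j, x i j * (if N.tail d = N.source i then b i j d else 0) := by
      simp only [mul_ite, mul_zero]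
      rw [← Finset.sum_subtype (p := fun i => N.source i = N.tail d)
        (Finset.univ.filter fun i => N.source i = N.tail d) (by simp)
        (fun i => ∑ j, x i j * b i j d), Finset.sum_filter]
      refine Finset.sum_congr rfl fun i _ => ?_
      simp only [eq_comm (a := N.tail d)]
      split_ifs <;> simp
    rw [hu d, Pi.add_apply]
    beta_reduce
    rw [h1, h2]
  have hx : ∑ d, (∑ i, ∑ j, x i j * (if N.tail d = N.source i then b i j d else 0)) • K d =
      ∑ i, ∑ j, x i j • g i j := by
    simp only [Finset.sum_smul, mul_smul]
    rw [Finset.sum_comm]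
    refine Finset.sum_congr rfl fun i _ => ?_
    rw [Finset.sum_comm]
    refine Finset.sum_congr rfl fun j _ => ?_
    rw [← Finset.smul_sum, hb]
  have he : ∑ d, (∑ e, u e 0 * (if N.head e = N.tail d then A e d else 0)) • K d =
      ∑ e, if N.head e = N.sink then 0 else u e 0 • K e := by
    simp only [Finset.sum_smul, mul_smul]
    rw [Finset.sum_comm]
    refine Finset.sum_congr rfl fun e _ => ?_
    rw [← Finset.smul_sum, hA]
    split_ifs <;> simp
  -- Each non-sink term `u e 0 • K e` reappears through its successors, so these terms cancel and
  -- only the edges into the sink remain.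
  have htot : ∑ d, u d 0 • K d = ∑ e, (if N.head e = N.sink then 0 else u e 0 • K e) +
      ∑ i, ∑ j, x i j • g i j + ∑ d, z d 0 • K d := by
    rw [← he, ← hx, ← Finset.sum_add_distrib, ← Finset.sum_add_distrib]
    exact Finset.sum_congr rfl fun d _ => by rw [← add_smul, ← add_smul, ← hu' d]
  have hsink : ∑ e : {e : E // N.head e = N.sink}, u e 0 • K e =
      ∑ e, if N.head e = N.sink then u e 0 • K e else 0 := by
    rw [← Finset.sum_filter, Finset.sum_subtype (p := fun e => N.head e = N.sink) _ (by simp)]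
  have hsplit : ∑ d, u d 0 • K d = ∑ e, (if N.head e = N.sink then 0 else u e 0 • K e) +
      ∑ e, if N.head e = N.sink then u e 0 • K e else 0 := by
    rw [← Finset.sum_add_distrib]
    exact Finset.sum_congr rfl fun e _ => by split_ifs <;> simp
  rw [hsink]
  rw [hsplit, add_assoc] at htot
  exact add_left_cancel htot

/-- The code of `exists_linear_enc` computes every linear target function whose value is
determined, up to errors on `2 * τ` edges, by `∑ x i j • g i j`. -/
theorem exists_computes_linearTarget {V E F M : Type*} {s k l τ : ℕ} (N : Network V E s) [Field F]
    [Finite E] [AddCommGroup M] [Module F M] (K : E → M)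
    (hK : ∀ e, K e ∈ N.outSpan F K (N.head e)) (g : Fin s → Fin k → M)
    (hg : ∀ i j, g i j ∈ N.outSpan F K (N.source i)) (T : Matrix (Fin s) (Fin l) F)
    (h : ∀ (ρ : Finset E) (x : Fin s → Fin k → F), ρ.card ≤ 2 * τ →
      ∑ i, ∑ j, x i j • g i j ∈ Submodule.span F (K '' ρ) →
        ∀ j, linearTarget T (fun i => x i j) = 0) :
    ∃ c : NetworkCode N F (Fin l → F) k 1, c.Computes (linearTarget T) τ := by
  classical
  have := Fintype.ofFinite E
  obtain ⟨enc, henc⟩ := N.exists_linear_enc K hK g hg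
  have huniq : ∀ (x x' : Fin s → Fin k → F) (ρ ρ' : Finset E) (z z' : E → Fin 1 → F),
      ρ.card ≤ τ → ρ'.card ≤ τ → (∀ e, e ∉ ρ → z e = 0) → (∀ e, e ∉ ρ' → z' e = 0) →
      ∑ i, ∑ j, x i j • g i j + ∑ e, z e 0 • K e =
        ∑ i, ∑ j, x' i j • g i j + ∑ e, z' e 0 • K e →
      ∀ j, linearTarget T (fun i => x i j) = linearTarget T (fun i => x' i j) := by
    intro x x' ρ ρ' z z' hρ hρ' hz hz' heq j
    have hsub : ∑ i, ∑ j, (x - x') i j • g i j = ∑ e, (z' e 0 - z e 0) • K e := by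
      simp only [Pi.sub_apply, sub_smul, Finset.sum_sub_distrib]
      rw [sub_eq_sub_iff_add_eq_add, heq, add_comm]
    have := h (ρ ∪ ρ') (x - x') ((Finset.card_union_le _ _).trans (by omega)) (by
      rw [hsub]
      refine Submodule.sum_mem _ fun e _ => ?_
      by_cases he : e ∈ ρ ∪ ρ'
      · exact Submodule.smul_mem _ _ (Submodule.subset_span ⟨e, he, rfl⟩)
      · rw [Finset.mem_union, not_or] at he
        simp [hz e he.1, hz' e he.2]) j
    have hlin : linearTarget T (fun i => (x - x') i j) =
        linearTarget T (fun i => x i j) - linearTarget T (fun i => x' i j) :=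
      Matrix.sub_vecMul T (fun i => x i j) (fun i => x' i j)
    rwa [hlin, sub_eq_zero] at this
  -- The decoder picks any message explaining the received vector with at most `τ` errors; `huniq`
  -- makes the target value independent of the choice.
  let Good : M → (Fin s → Fin k → F) → Prop := fun y x => ∃ (ρ : Finset E) (z : E → Fin 1 → F),
    ρ.card ≤ τ ∧ (∀ e, e ∉ ρ → z e = 0) ∧
      y = ∑ i, ∑ j, x i j • g i j + ∑ e, z e 0 • K e
  refine ⟨⟨enc, fun u j => if hx : ∃ x, Good (∑ e, u e 0 • K e) x then
    linearTarget T (fun i => hx.choose i j) else 0⟩, fun x ρ z u hρ hz hu => ?_⟩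
  have hgood : ∃ x, Good (∑ e : {e : E // N.head e = N.sink}, u e 0 • K e) x :=
    ⟨x, ρ, z, hρ, hz, henc x z u hu⟩
  funext j
  simp only [dif_pos hgood]
  obtain ⟨ρ', z', hρ', hz', heq⟩ := hgood.choose_spec
  exact huniq _ _ ρ' ρ z' z hρ' hρ hz' hz (heq.symm.trans (henc x z u hu)) j

end Network

/-! ### Cut-set upper bound -/

theorem Finset.exists_initial_subset {α : Type*} [DecidableEq α] {i : α → ℕ}
    (hi : Function.Injective i) (C : Finset α) (m : ℕ) (hm : m ≤ C.card) :
    ∃ T ⊆ C, T.card = m ∧ ∀ a ∈ T, ∀ b ∈ C \ T, i a < i b := by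
  induction m with
  | zero => exact ⟨∅, by simp, rfl, by simp⟩
  | succ m ih =>
    obtain ⟨T, hTC, hcard, hT⟩ := ih (by omega)
    obtain ⟨a, ha, hmin⟩ := (C \ T).exists_min_image i (by
      rw [← Finset.card_pos, Finset.card_sdiff_of_subset hTC]
      omega)
    have ha' := Finset.mem_sdiff.1 ha
    refine ⟨insert a T, Finset.insert_subset ha'.1 hTC, by
      rw [Finset.card_insert_of_notMem ha'.2, hcard], fun c hc b hb => ?_⟩
    rw [Finset.mem_sdiff, Finset.mem_insert, not_or] at hb
    have hb' : b ∈ C \ T := Finset.mem_sdiff.2 ⟨hb.1, hb.2.2⟩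
    rcases Finset.mem_insert.1 hc with rfl | hc
    · exact lt_of_le_of_ne (hmin b hb') fun h => hb.2.1 (hi h).symm
    · exact hT c hc b hb'

namespace NetworkCode

variable {V E A O : Type*} {s k n : ℕ} {N : Network V E s}

/-- The messages `u` are processed without error by the edges outside `T`. -/
def FollowsOutside (c : NetworkCode N A O k n) (x : Fin s → Fin k → A) (T : Finset E)
    (u : E → Fin n → A) : Prop :=
  ∀ e, e ∉ T → u e = c.enc e (fun i => x i) (fun d => u d)

/-- Arbitrary errors on `T` amount to prescribing the messages there: a modified code ignores its
inputs on `T`, and runs without error. -/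
theorem exists_followsOutside [AddZeroClass A] [Finite E] (c : NetworkCode N A O k n)
    (x : Fin s → Fin k → A) (T : Finset E) (t : E → Fin n → A) :
    ∃ u, c.FollowsOutside x T u ∧ ∀ e ∈ T, u e = t e := by
  classical
  let c' : NetworkCode N A O k n :=
    ⟨fun e x u => if e ∈ T then t e else c.enc e x u, c.dec⟩
  obtain ⟨u, hu, -⟩ := c'.existsUnique_isTransmission x 0
  refine ⟨u, fun e he => ?_, fun e he => ?_⟩
  · rw [hu e]
    simp [c', he]
  · rw [hu e]
    simp [c', he]

theorem FollowsOutside.dec_eq [AddCommGroup A] {c : NetworkCode N A O k n}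
    {x : Fin s → Fin k → A} {T : Finset E} {u : E → Fin n → A} (hu : c.FollowsOutside x T u)
    {f : (Fin s → A) → O} {τ : ℕ} (hc : c.Computes f τ) (hT : T.card ≤ τ) :
    c.dec (fun e => u e) = fun j => f (fun i => x i j) :=
  hc x T (fun e => u e - c.enc e (fun i => x i) (fun d => u d)) u hT
    (fun e he => sub_eq_zero.2 (hu e he)) (fun e => by simp)

/-- Causality: the inputs of an edge have smaller numbers, so deviations only propagate forward. -/
theorem FollowsOutside.eq_of_lt {c : NetworkCode N A O k n} {i : E → ℕ}
    (hi : ∀ d e, N.head d = N.tail e → i d < i e) {x : Fin s → Fin k → A} {T T' : Finset E}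
    {u u' : E → Fin n → A} (hu : c.FollowsOutside x T u) (hu' : c.FollowsOutside x T' u') (e : E)
    (he : ∀ b, b ∈ T ∨ b ∈ T' → i e < i b) : u e = u' e := by
  induction h : i e using Nat.strong_induction_on generalizing e with
  | _ m ih =>
    have hT : e ∉ T := fun h => (he e (.inl h)).false
    have hT' : e ∉ T' := fun h => (he e (.inr h)).false
    rw [hu e hT, hu' e hT']
    congr 1
    funext d
    have hd := hi d.1 e d.2
    exact ih _ (h ▸ hd) d.1 (fun b hb => hd.trans (he b hb)) rfl

/-- What the sink receives is determined by the messages on a cut and by the sources not separated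
by this cut. -/
theorem FollowsOutside.eq_at_sink {c : NetworkCode N A O k n} [Finite E]
    {x x' : Fin s → Fin k → A} {T T' C : Finset E}
    {u u' : E → Fin n → A} (hu : c.FollowsOutside x T u) (hu' : c.FollowsOutside x' T' u')
    (hTC : T ⊆ C) (hTC' : T' ⊆ C) (hC : ∀ e ∈ C, u e = u' e)
    (hx : ∀ i, N.Reaches C (N.source i) N.sink → x i = x' i) (e : E) (he : N.head e = N.sink) :
    u e = u' e := by
  obtain ⟨i, -, hi⟩ := N.exists_topological_numbering
  have key : ∀ (m : ℕ) (e : E), i e = m → (N.head e = N.sink ∨ N.Reaches C (N.head e) N.sink) →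
      u e = u' e := by
    intro m
    induction m using Nat.strong_induction_on with
    | _ m ih =>
      intro e hm h
      by_cases heC : e ∈ C
      · exact hC e heC
      have htail : N.Reaches C (N.tail e) N.sink := by
        rcases h with h | h
        · exact .single ⟨e, heC, rfl, h⟩
        · exact Relation.TransGen.head ⟨e, heC, rfl, rfl⟩ h
      rw [hu e fun h => heC (hTC h), hu' e fun h => heC (hTC' h)]
      congr 1
      · funext ⟨j, hj⟩
        exact hx j (by rwa [hj])
      · funext ⟨d, hd⟩
        exact ih _ (hm ▸ hi d e hd) d rfl (.inr (by rwa [hd]))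
  exact key _ e rfl (.inl he)

/-- The cut-set bound for the sum function. -/
theorem le_of_computes_sum {F : Type*} [Field F] [Finite F] [Finite E] {τ : ℕ}
    (c : NetworkCode N F (Fin 1 → F) k n)
    (hc : c.Computes (linearTarget (Matrix.of fun _ _ => 1 : Matrix (Fin s) (Fin 1) F)) τ)
    {C : Finset E} (hC : C ∈ N.cuts) (hτ : 2 * τ ≤ C.card) : k ≤ n * (C.card - 2 * τ) := by
  classical
  by_contra! hlt
  have := Fintype.ofFinite F
  obtain ⟨i₀, hi₀⟩ := hC
  obtain ⟨i, hinj, hi⟩ := N.exists_topological_numbering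
  obtain ⟨C₁, hC₁, hcard₁, hlt₁⟩ := C.exists_initial_subset hinj (C.card - 2 * τ) (by omega)
  have hcard' : (C \ C₁).card = 2 * τ := by
    rw [Finset.card_sdiff_of_subset hC₁]
    omega
  obtain ⟨C₂, hC₂, hcard₂, hlt₂⟩ := (C \ C₁).exists_initial_subset hinj τ (by omega)
  set C₃ := (C \ C₁) \ C₂ with hC₃
  have hcard₃ : C₃.card = τ := by
    rw [hC₃, Finset.card_sdiff_of_subset hC₂]
    omega
  have hlt₁₂ : ∀ a ∈ C₁, ∀ b ∈ C₂, i a < i b := fun a ha b hb => hlt₁ a ha b (hC₂ hb)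
  have hlt₁₃ : ∀ a ∈ C₁, ∀ b ∈ C₃, i a < i b := fun a ha b hb =>
    hlt₁ a ha b (Finset.sdiff_subset hb)
  -- Only the separated source `i₀` is active, so the sum equals `y` itself.
  let X : (Fin k → F) → Fin s → Fin k → F := fun y i j => if i = i₀ then y j else 0
  choose u hu using fun y => c.exists_followsOutside (X y) ∅ 0
  obtain ⟨y, y', hne, heq⟩ : ∃ y y', y ≠ y' ∧ (fun e : C₁ => u y e) = fun e : C₁ => u y' e := by
    obtain ⟨y, y', hne, heq⟩ := Fintype.exists_ne_map_eq_of_card_lt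
      (fun (y : Fin k → F) (e : C₁) => u y e) (by
        simp only [Fintype.card_fun, Fintype.card_fin, Fintype.card_coe, hcard₁, ← pow_mul]
        exact Nat.pow_lt_pow_right Fintype.one_lt_card hlt)
    exact ⟨y, y', hne, heq⟩
  -- Errors on `C₂` make `y` look like `y'` on `C₁ ∪ C₂`; errors on `C₃` then make `y'` look like
  -- this corrupted run. As `C₃` comes last, the second forgery leaves `C₁ ∪ C₂` untouched.
  obtain ⟨v, hv, hvC⟩ := c.exists_followsOutside (X y) C₂ (u y')
  obtain ⟨v', hv', hvC'⟩ := c.exists_followsOutside (X y') C₃ v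
  have hv₁ : ∀ e ∈ C₁, v e = u y' e := fun e he =>
    (hv.eq_of_lt hi (hu y).1 e (by simpa using hlt₁₂ e he)).trans (congrFun heq ⟨e, he⟩)
  have hCeq : ∀ e ∈ C, v e = v' e := by
    intro e he
    by_cases h₁ : e ∈ C₁
    · rw [hv₁ e h₁]
      exact (hu y').1.eq_of_lt hi hv' e (by simpa using hlt₁₃ e h₁)
    by_cases h₂ : e ∈ C₂
    · rw [hvC e h₂]
      exact (hu y').1.eq_of_lt hi hv' e (by simpa using hlt₂ e h₂)
    · exact (hvC' e (by simp [hC₃, he, h₁, h₂])).symm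
  have hsink := hv.eq_at_sink hv' (hC₂.trans Finset.sdiff_subset)
    (Finset.sdiff_subset.trans Finset.sdiff_subset) hCeq (by
      intro i hr
      have : i ≠ i₀ := by
        rintro rfl
        exact hi₀ hr
      simp [X, this])
  have hdec := (hv.dec_eq hc hcard₂.le).symm.trans ((congrArg c.dec
    (funext fun e => hsink e.1 e.2)).trans (hv'.dec_eq hc hcard₃.le))
  apply hne
  funext j
  simpa [linearTarget, Matrix.vecMul, dotProduct, X] using congrFun (congrFun hdec j) 0

end NetworkCode

/-! ### Achievability by generic linear codes -/

/-- The relation makes one `g b₀` with nonzero coefficient redundant, which saves one generator. -/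
theorem finrank_span_range_sup_span_lt {F M E B : Type*} [Field F] [AddCommGroup M] [Module F M]
    [Fintype B] (K : E → M) (g : B → M) (ρ : Finset E) {c : B → F} (hc : c ≠ 0)
    (h : ∑ b, c b • g b ∈ Submodule.span F (K '' ρ)) :
    Module.finrank F ↥(Submodule.span F (Set.range g) ⊔ Submodule.span F (K '' ρ)) <
      Fintype.card B + ρ.card := by
  classical
  obtain ⟨b₀, hb₀⟩ := Function.ne_iff.1 hc
  let Z : Finset M := (Finset.univ.erase b₀).image g ∪ ρ.image K
  have hK : Submodule.span F (K '' ρ) ≤ Submodule.span F (Z : Set M) :=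
    Submodule.span_mono (by simp [Z])
  have hg : ∀ b, b ≠ b₀ → g b ∈ Submodule.span F (Z : Set M) := fun b hb =>
    Submodule.subset_span (Finset.mem_coe.2 (Finset.mem_union_left _
      (Finset.mem_image_of_mem _ (by simp [hb]))))
  have hg₀ : g b₀ ∈ Submodule.span F (Z : Set M) := by
    have h' := hK h
    rw [← Finset.add_sum_erase _ _ (Finset.mem_univ b₀), Submodule.add_mem_iff_left _
      (Submodule.sum_mem _ fun b hb => Submodule.smul_mem _ _ (hg b (Finset.ne_of_mem_erase hb))),
      Submodule.smul_mem_iff _ hb₀] at h'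
    exact h'
  have hle : Submodule.span F (Set.range g) ⊔ Submodule.span F (K '' ρ) ≤
      Submodule.span F (Z : Set M) := by
    refine sup_le (Submodule.span_le.2 ?_) hK
    rintro _ ⟨b, rfl⟩
    by_cases hb : b = b₀
    · exact hb ▸ hg₀
    · exact hg b hb
  have h1 := Submodule.finrank_mono hle
  have h2 : Module.finrank F (Submodule.span F (Z : Set M)) ≤ Z.card :=
    finrank_span_finset_le_card Z
  have h3 : Z.card ≤ (Finset.univ.erase b₀).card + ρ.card :=
    (Finset.card_union_le _ _).trans (add_le_add Finset.card_image_le Finset.card_image_le)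
  rw [Finset.card_erase_of_mem (Finset.mem_univ _), Finset.card_univ] at h3
  have := Fintype.card_pos_iff.2 ⟨b₀⟩
  omega

namespace Network

variable {V E : Type*} {s : ℕ}

theorem univ_mem_cuts [Fintype E] (hs : 1 ≤ s) (N : Network V E s) : Finset.univ ∈ N.cuts := by
  refine ⟨⟨0, hs⟩, fun h => ?_⟩
  obtain ⟨_, ⟨e, he, -⟩, -⟩ := (Relation.TransGen.head'_iff).1 h
  exact he (Finset.mem_univ e)

theorem separated_univ [Fintype E] (N : Network V E s) :
    N.separated Finset.univ = Set.univ := by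
  refine Set.eq_univ_of_forall fun i h => ?_
  obtain ⟨_, ⟨e, he, -⟩, -⟩ := (Relation.TransGen.head'_iff).1 h
  exact he (Finset.mem_univ e)

/-- Robust linear network codes for the sum function. -/
theorem exists_computes_sum [Finite E] (N : Network V E s) {τ w : ℕ}
    (hw : ∀ C ∈ N.cuts, w + 2 * τ ≤ C.card) (F : Type*) [Field F] [Finite F]
    (hF : 2 ^ (Nat.card E + w) < Nat.card F) :
    ∃ c : NetworkCode N F (Fin 1 → F) w 1,
      c.Computes (linearTarget (Matrix.of fun _ _ => 1 : Matrix (Fin s) (Fin 1) F)) τ := by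
  classical
  have := Fintype.ofFinite E
  obtain ⟨K, g, hK, -, hind, hcard⟩ := N.exists_generic_coding_vectors (F := F)
    (M := Fin (w + 2 * τ) → F) (B := Fin w) (fun _ => N.sink) (by simpa using hF)
  have hsrc : ∀ i, N.outSpan F K (N.source i) = ⊤ := by
    intro i
    by_contra hU
    set U := N.outSpan F K (N.source i) with hUdef
    let C : Finset E := Finset.univ.filter fun e => K e ∈ U ∧ ¬ N.outSpan F K (N.head e) ≤ U
    have hC : ∀ e, e ∈ C ↔ K e ∈ U ∧ ¬ N.outSpan F K (N.head e) ≤ U := fun e => by simp [C]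
    have h1 := hcard U C ∅ (fun e he => ((hC e).1 he).1) (fun e he => ((hC e).1 he).2)
      (by simp) (by simp)
    have h2 := Submodule.finrank_lt hU
    have h3 := hw C ⟨i, N.mem_separated_of_outSpan_le K hU C (fun e h h' => (hC e).2 ⟨h, h'⟩)
      hUdef.ge⟩
    rw [Module.finrank_fin_fun] at h2
    rw [Finset.card_empty] at h1
    omega
  refine N.exists_computes_linearTarget K hK (fun _ => g)
    (fun i _ => by rw [hsrc i]; trivial) _ fun ρ x hρ hx => ?_
  have hx' : ∑ j, (∑ i, x i j) • g j ∈ Submodule.span F (K '' ρ) := by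
    simp only [Finset.sum_smul]
    rwa [Finset.sum_comm]
  suffices h0 : (fun j => ∑ i, x i j) = 0 by
    intro j
    funext l
    simpa [linearTarget, Matrix.vecMul, dotProduct] using congrFun h0 j
  by_contra h0
  have hlt := finrank_span_range_sup_span_lt K g ρ h0 hx'
  set U := Submodule.span F (Set.range g) ⊔ Submodule.span F (K '' ρ)
  -- The dimension of `U` is less than `w + 2τ`, hence `U` is proper and contains no space available
  -- at the sink.
  have hU : U ≠ ⊤ := by
    intro hU
    rw [hU, finrank_top, Module.finrank_fin_fun, Fintype.card_fin] at hlt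
    omega
  exact h0 (hind U ρ
    (fun e he => Submodule.mem_sup_right (Submodule.subset_span ⟨e, he, rfl⟩))
    (fun b => Submodule.mem_sup_left (Submodule.subset_span ⟨b, rfl⟩))
    (fun b h => hU (top_le_iff.1 (by rwa [N.outSpan_sink] at h))) _ hx')

/-- Robust linear network codes transmitting all source messages. -/
theorem exists_computes_id [Finite E] (N : Network V E s) {τ r : ℕ}
    (hr : ∀ C ∈ N.cuts, r * (N.separated C).ncard + 2 * τ ≤ C.card) (F : Type*) [Field F]
    [Finite F] (hF : 2 ^ (Nat.card E + s * r) < Nat.card F) :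
    ∃ c : NetworkCode N F (Fin s → F) r 1,
      c.Computes (linearTarget (1 : Matrix (Fin s) (Fin s) F)) τ := by
  classical
  have := Fintype.ofFinite E
  -- Dimension `|E|` lets the cut consisting of all edges settle the case `U = ⊤`, where the edges
  -- of `C` need not form a cut.
  obtain ⟨K, g, hK, hg, hind, hcard⟩ := N.exists_generic_coding_vectors (F := F)
    (M := Fin (Fintype.card E) → F) (B := Fin s × Fin r) (fun b => N.source b.1)
    (by simpa using hF)
  refine N.exists_computes_linearTarget K hK (fun i j => g (i, j))
    (fun i j => hg (i, j)) _ fun ρ x hρ hx => ?_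
  rw [← Fintype.sum_prod_type' (fun i j => x i j • g (i, j))] at hx
  suffices h0 : (fun b : Fin s × Fin r => x b.1 b.2) = 0 by
    intro j
    funext i
    simpa [linearTarget] using congrFun h0 (i, j)
  by_contra h0
  have hlt := finrank_span_range_sup_span_lt K g ρ h0 hx
  set U := Submodule.span F (Set.range g) ⊔ Submodule.span F (K '' ρ)
  have hgU : ∀ b, g b ∈ U := fun b => Submodule.mem_sup_left (Submodule.subset_span ⟨b, rfl⟩)
  rw [Fintype.card_prod, Fintype.card_fin, Fintype.card_fin] at hlt
  obtain ⟨b₀, hb₀⟩ : ∃ b, N.outSpan F K (N.source (Prod.fst b)) ≤ U := by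
    by_contra! h
    exact h0 (hind U ρ
      (fun e he => Submodule.mem_sup_right (Submodule.subset_span ⟨e, he, rfl⟩)) hgU h _ hx)
  by_cases hU : U = ⊤
  · have h1 := hr Finset.univ (N.univ_mem_cuts (Nat.one_le_iff_ne_zero.2 (by
      have := b₀.1.2
      omega)))
    rw [N.separated_univ, Set.ncard_univ, Nat.card_fin, Finset.card_univ, mul_comm] at h1
    rw [hU, finrank_top, Module.finrank_fin_fun] at hlt
    omega
  let C : Finset E := Finset.univ.filter fun e => K e ∈ U ∧ ¬ N.outSpan F K (N.head e) ≤ U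
  have hC : ∀ e, e ∈ C ↔ K e ∈ U ∧ ¬ N.outSpan F K (N.head e) ≤ U := fun e => by simp [C]
  let I : Finset (Fin s) := Finset.univ.filter fun i => N.outSpan F K (N.source i) ≤ U
  have hI : ∀ i ∈ I, i ∈ N.separated C := fun i hi =>
    N.mem_separated_of_outSpan_le K hU C (fun e h h' => (hC e).2 ⟨h, h'⟩) (by simpa [I] using hi)
  -- Counting also the `g` of the sources outside `I` gives `|C| + (s - |I|) r ≤ dim U < s r + 2τ`,
  -- so `|C| < r |I| + 2τ`, against `hr`.
  have h1 := hcard U C (Iᶜ ×ˢ Finset.univ) (fun e he => ((hC e).1 he).1)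
    (fun e he => ((hC e).1 he).2) (fun b _ => hgU b)
    (by simp [I])
  have h2 := hr C ⟨b₀.1, hI b₀.1 (by simpa [I] using hb₀)⟩
  have h3 : I.card ≤ (N.separated C).ncard := by
    rw [← Set.ncard_coe_finset]
    exact Set.ncard_le_ncard hI (Set.toFinite _)
  have h4 : I.card + Iᶜ.card = s := by simp
  have h5 := Nat.mul_le_mul_left r h3
  rw [Finset.card_product, Finset.card_univ, Fintype.card_fin] at h1
  have h6 : s * r = r * I.card + Iᶜ.card * r := by
    conv_lhs => rw [← h4]
    ring
  omega

/-! ### Capacities -/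

theorem le_robustCapacity_of_computes {A O : Type*} [AddZeroClass A] (N : Network V E s) {τ k : ℕ}
    {f : (Fin s → A) → O} (c : NetworkCode N A O k 1) (hc : c.Computes f τ) :
    (k : ℝ≥0∞) ≤ robustCapacity N f τ := by
  rcases Nat.eq_zero_or_pos k with rfl | hk
  · simp
  · exact le_sSup ⟨k, 1, hk, one_pos, ⟨c, hc⟩, by simp⟩

/-- A minimum over the nonempty set of cuts is attained. -/
theorem exists_forall_cuts_le (N : Network V E s) (h : N.cuts.Nonempty) (a : Finset E → ℕ) :
    ∃ r, (∀ C ∈ N.cuts, r ≤ a C) ∧ (⨅ C ∈ N.cuts, (a C : ℝ≥0∞)) = r := by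
  obtain ⟨C₀, hC₀, hmin⟩ := exists_minimalFor_of_wellFoundedLT (· ∈ N.cuts) a h
  have hle : ∀ C ∈ N.cuts, a C₀ ≤ a C := fun C hC =>
    (le_total (a C₀) (a C)).elim id fun h => hmin hC h
  exact ⟨a C₀, hle, le_antisymm (iInf₂_le C₀ hC₀) (le_iInf₂ fun C hC => by
    exact_mod_cast hle C hC)⟩

end Network

theorem mainTheorem3 {V E : Type*} [Finite V] [Finite E] {s : ℕ} (hs : 1 ≤ s)
    (N : Network V E s) (τ : ℕ) (hτ : 1 ≤ τ) (hcut : ∀ C ∈ N.cuts, 2 * τ < C.card) :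
    ∃ q₀ : ℕ, ∀ (F : Type*) [Field F] [Finite F], q₀ ≤ Nat.card F →
      (robustCapacity N (linearTarget (Matrix.of fun _ _ => 1 : Matrix (Fin s) (Fin 1) F)) τ =
          (⨅ C ∈ N.cuts, ((C.card - 2 * τ : ℕ) : ℝ≥0∞))) ∧
        ((⨅ C ∈ N.cuts, ((⌊((C.card : ℝ) - 2 * τ) / (N.separated C).ncard⌋₊ : ℕ) : ℝ≥0∞)) ≤
          robustCapacity N (linearTarget (1 : Matrix (Fin s) (Fin s) F)) τ) := by
  have := Fintype.ofFinite E
  have hne : N.cuts.Nonempty := ⟨_, N.univ_mem_cuts hs⟩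
  obtain ⟨w, hw, hw'⟩ := N.exists_forall_cuts_le hne fun C => C.card - 2 * τ
  obtain ⟨r, hr, hr'⟩ := N.exists_forall_cuts_le hne
    fun C => ⌊((C.card : ℝ) - 2 * τ) / (N.separated C).ncard⌋₊
  -- The exponent covers both constructions; the `+ 1` makes their bounds on the field size strict.
  refine ⟨2 ^ (Nat.card E + w + s * r) + 1, fun F _ _ hF => ⟨le_antisymm ?_ ?_, ?_⟩⟩
  · refine le_iInf₂ fun C hC => sSup_le ?_
    rintro _ ⟨k, n, -, hn, ⟨c, hc⟩, rfl⟩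
    refine ENNReal.div_le_of_le_mul' ?_
    exact_mod_cast c.le_of_computes_sum hc hC (hcut C hC).le
  · rw [hw']
    obtain ⟨c, hc⟩ := N.exists_computes_sum (τ := τ) (w := w) (fun C hC => by
      have := hw C hC
      have := hcut C hC
      omega) F ((Nat.pow_le_pow_right two_pos (by omega)).trans_lt hF)
    exact N.le_robustCapacity_of_computes c hc
  · rw [hr']
    obtain ⟨c, hc⟩ := N.exists_computes_id (τ := τ) (r := r) (fun C hC => by
      have hpos : 0 < (N.separated C).ncard := (Set.ncard_pos (Set.toFinite _)).2 hC
      have hlt : (2 * τ : ℝ) < C.card := by exact_mod_cast hcut C hC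
      have h1 := (Nat.le_floor_iff (by
        have : (0 : ℝ) ≤ (N.separated C).ncard := Nat.cast_nonneg _
        exact div_nonneg (by linarith) this)).1 (hr C hC)
      rw [le_div_iff₀ (by exact_mod_cast hpos)] at h1
      have h2 : (r * (N.separated C).ncard + 2 * τ : ℝ) ≤ C.card := by linarith
      exact_mod_cast h2) F ((Nat.pow_le_pow_right two_pos (by omega)).trans_lt hF)
    exact N.le_robustCapacity_of_computes c hc
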